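/- For every positive integer $n$, in the integers, $$4(2n+1)\binom{2n}{n}\ \Big|\ \sum_{k=0}^{n}(4k+1)\binom{2k}{k}^3(-64)^{n-k}$$ and $$4(2n+1)\binom{2n}{n}\ \Big|\ \sum_{k=0}^{n}(20k+3)\binom{2k}{k}^2\binom{4k}{2k}(-2^{10})^{n-k}.$$ -/

import Mathlib

/-! Each summand, divided by its power of -64 or -1024, is the boundary value `F n 0` of a
Wilf–Zeilberger pair. As `F n k` vanishes for `k > n` and `G 0 k = 0`, summing the pair relation
over a square telescopes both ways and turns the partial sum into `∑ k, G (n + 1) k`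
(`sum_eq_sum_of_wz`).

The gain is that, after rescaling, every term on the `G` side separately contains the divisor `4 (2n
+ 1) (2n choose n)` (`cubeG_succ`, `quarticG_succ`). The cofactor is `± 4 ^ k / 4` or `± 4 ^ k / 8`
times two values of `halfBinom`, which are integers, and their 2-divisibility clears the remaining
denominator. -/

/-! ### Half-integer rising factorials -/

/-- The rising factorial `(1/2)(3/2)⋯(n - 1/2)`. -/
def halfRising : ℕ → ℚ
  | 0 => 1
  | n + 1 => ((n : ℚ) + 1 / 2) * halfRising n

theorem halfRising_zero : halfRising 0 = 1 := rfl

theorem halfRising_succ (n : ℕ) : halfRising (n + 1) = ((n : ℚ) + 1 / 2) * halfRising n := rfl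

theorem halfRising_ne_zero (n : ℕ) : halfRising n ≠ 0 := by
  induction n with
  | zero => simp [halfRising_zero]
  | succ n ih =>
    rw [halfRising_succ]
    exact mul_ne_zero (by positivity) ih

theorem four_pow_mul_halfRising (n : ℕ) :
    (4 : ℚ) ^ n * halfRising n = n.centralBinom * n.factorial := by
  induction n with
  | zero => simp [halfRising_zero]
  | succ n ih =>
    have h : ((n : ℚ) + 1) * (n + 1).centralBinom = 2 * (2 * n + 1) * n.centralBinom := by
      exact_mod_cast Nat.succ_mul_centralBinom_succ n
    rw [halfRising_succ, Nat.factorial_succ]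
    push_cast
    linear_combination 4 * ((n : ℚ) + 1 / 2) * ih - (n.factorial : ℚ) * h

/-- Duplication formula: it splits the `(2 * n + 1)!` in the quartic cofactor so that it cancels. -/
theorem halfRising_succ_mul_factorial (n : ℕ) :
    halfRising (n + 1) * n.factorial * 2 ^ (2 * n + 1) = (2 * n + 1).factorial := by
  induction n with
  | zero => simp [halfRising_succ, halfRising_zero]
  | succ n ih =>
    rw [halfRising_succ, show 2 * (n + 1) + 1 = 2 * n + 1 + 1 + 1 by ring,
      Nat.factorial_succ (2 * n + 1 + 1), Nat.factorial_succ (2 * n + 1), Nat.factorial_succ n]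
    push_cast
    rw [← ih]
    ring

/-! ### Integer coefficients and their 2-divisibility -/

/-- The coefficient of `x ^ m` in `(1 - 4 * x) ^ (-(k + 1 / 2))`. -/
def halfBinom : ℕ → ℕ → ℕ
  | m, 0 => m.centralBinom
  | 0, _ + 1 => 1
  | m + 1, k + 1 => halfBinom (m + 1) k + 4 * halfBinom m (k + 1)
termination_by m k => m + k

/-- Multiplying the series by `1 - 4 * x` lowers `k` by one, which is the recurrence defining
`halfBinom`; the closed form satisfies the same recurrence and boundary values. -/
theorem halfBinom_mul (m k : ℕ) :
    (halfBinom m k : ℚ) * m.factorial * halfRising k = 4 ^ m * halfRising (m + k) := by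
  induction m, k using halfBinom.induct with
  | case1 m =>
    rw [halfBinom, halfRising_zero, add_zero, four_pow_mul_halfRising, mul_one]
  | case2 k => simp [halfBinom]
  | case3 m k ih₁ ih₂ =>
    rw [halfBinom]
    rw [show m + (k + 1) = m + 1 + k by ring] at ih₂
    rw [show m + 1 + (k + 1) = m + 1 + k + 1 by ring, halfRising_succ (m + 1 + k),
      halfRising_succ k]
    rw [halfRising_succ k] at ih₂
    rw [Nat.factorial_succ] at ih₁ ⊢
    rw [Nat.succ_eq_add_one]
    push_cast at ih₁ ih₂ ⊢
    linear_combination ((k : ℚ) + 1 / 2) * ih₁ + 4 * ((m : ℚ) + 1) * ih₂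

/-- Central binomials of positive index are even, and raising `k` only adds multiples of 4. -/
theorem two_dvd_halfBinom {m : ℕ} (hm : 0 < m) (k : ℕ) : 2 ∣ halfBinom m k := by
  obtain ⟨m, rfl⟩ := Nat.exists_eq_succ_of_ne_zero hm.ne'
  induction k with
  | zero =>
    rw [halfBinom]
    exact Nat.two_dvd_centralBinom_succ m
  | succ k ih =>
    rw [Nat.succ_eq_add_one, halfBinom]
    exact dvd_add ih ((by norm_num : 2 ∣ 4).mul_right _)

theorem four_dvd_halfBinom_one {n : ℕ} (hn : 0 < n) : 4 ∣ halfBinom (2 * n + 1) 1 := by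
  rw [halfBinom, halfBinom]
  refine dvd_add ?_ (dvd_mul_right _ _)
  have hodd : Nat.Coprime 4 (2 * n + 1) := by
    rw [show 4 = 2 ^ 2 by norm_num]
    exact Nat.Coprime.pow_left 2 (by simp)
  -- Multiplying by the odd `2 * n + 1` gives `2 * (4 * n + 1)` times the central binomial of `2 *
  -- n`, which supplies the second factor 2.
  refine hodd.dvd_of_dvd_mul_left ?_
  obtain ⟨c, hc⟩ := Nat.two_dvd_centralBinom_of_one_le (n := 2 * n) (by omega)
  rw [Nat.succ_mul_centralBinom_succ, hc]
  exact ⟨(2 * (2 * n) + 1) * c, by ring⟩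

/-! ### Wilf–Zeilberger pairs -/

/-- Summation of a Wilf–Zeilberger pair over a triangle. -/
theorem sum_eq_sum_of_wz {F G : ℕ → ℕ → ℚ}
    (hwz : ∀ n k, F n k - F n (k + 1) = G (n + 1) k - G n k)
    (hF : ∀ n k, n < k → F n k = 0) (hG : ∀ k, G 0 k = 0) (N : ℕ) :
    ∑ n ∈ Finset.range N, F n 0 = ∑ k ∈ Finset.range N, G N k := by
  have h₁ (n : ℕ) (hn : n ∈ Finset.range N) :
      F n 0 = ∑ k ∈ Finset.range N, (G (n + 1) k - G n k) := by
    simp_rw [← hwz]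
    -- Telescoping in `k` leaves `F n 0 - F n N`, and `n < N` kills the second term.
    rw [Finset.sum_range_sub', hF n N (Finset.mem_range.mp hn), sub_zero]
  rw [Finset.sum_congr rfl h₁, Finset.sum_comm]
  refine Finset.sum_congr rfl fun k _ => ?_
  rw [Finset.sum_range_sub (fun n => G n k), hG, sub_zero]

/-- Untruncated subtraction is harmless: the falling factorial is already zero when `k > n`. This
lets the pair identities hold for all `n` and `k`. -/
theorem cast_descFactorial_succ (n k : ℕ) :
    (n.descFactorial (k + 1) : ℚ) = ((n : ℚ) - k) * n.descFactorial k := by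
  rw [Nat.descFactorial_succ]
  rcases le_or_gt k n with h | h
  · push_cast [h]
    ring
  · simp [Nat.descFactorial_of_lt h]

/-- First component of the Wilf–Zeilberger pair for `∑ (4 n + 1) (2n choose n) ^ 3 / (-64) ^ n`. -/
def cubeF (n k : ℕ) : ℚ :=
  (-1) ^ (n + k) * (4 * n + 1) * halfRising n ^ 2 * halfRising (n + k) * n.descFactorial k /
    (n.factorial ^ 3 * halfRising k ^ 2)

/-- Companion of `cubeF`. -/
def cubeG (n k : ℕ) : ℚ :=
  -2 * (-1) ^ (n + k) * n ^ 2 * halfRising n ^ 2 * halfRising (n + k) *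
    n.descFactorial (k + 1) / (n.factorial ^ 3 * halfRising (k + 1) ^ 2)

theorem cube_wz (n k : ℕ) :
    cubeF n k - cubeF n (k + 1) = cubeG (n + 1) k - cubeG n k := by
  have hk := halfRising_ne_zero k
  have hf : (n.factorial : ℚ) ≠ 0 := by positivity
  have hk2 : (k : ℚ) + 1 / 2 ≠ 0 := by positivity
  have hn1 : (n : ℚ) + 1 ≠ 0 := by positivity
  simp only [cubeF, cubeG]
  rw [show n + (k + 1) = n + k + 1 by ring, show n + 1 + k = n + k + 1 by ring,
    Nat.succ_descFactorial_succ, Nat.factorial_succ, halfRising_succ (n + k), halfRising_succ n,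
    halfRising_succ k]
  push_cast
  rw [cast_descFactorial_succ]
  field_simp
  ring

/-- First component of the Wilf–Zeilberger pair for
`∑ (20 n + 3) (2n choose n) ^ 2 (4n choose 2n) / (-1024) ^ n`. -/
def quarticF (n k : ℕ) : ℚ :=
  (-1) ^ (n + k) * (20 * n - 2 * k + 3) * halfRising n * halfRising (2 * n + k) *
    n.descFactorial k / (16 ^ n * n.factorial ^ 3 * halfRising k ^ 2)

/-- Companion of `quarticF`. -/
def quarticG (n k : ℕ) : ℚ :=
  -32 * (-1) ^ (n + k) * n ^ 2 * halfRising n * halfRising (2 * n + k) *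
    n.descFactorial (k + 1) / (16 ^ n * n.factorial ^ 3 * halfRising (k + 1) ^ 2)

theorem quartic_wz (n k : ℕ) :
    quarticF n k - quarticF n (k + 1) = quarticG (n + 1) k - quarticG n k := by
  have hk := halfRising_ne_zero k
  have hf : (n.factorial : ℚ) ≠ 0 := by positivity
  have hk2 : (k : ℚ) + 1 / 2 ≠ 0 := by positivity
  have hn1 : (n : ℚ) + 1 ≠ 0 := by positivity
  simp only [quarticF, quarticG]
  rw [show 2 * n + (k + 1) = 2 * n + k + 1 by ring,
    show 2 * (n + 1) + k = 2 * n + k + 1 + 1 by ring,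
    Nat.succ_descFactorial_succ, Nat.factorial_succ, halfRising_succ (2 * n + k + 1),
    halfRising_succ (2 * n + k), halfRising_succ n, halfRising_succ k]
  push_cast
  rw [cast_descFactorial_succ]
  field_simp
  ring

/-! ### Boundary values and companions in terms of binomials -/

theorem halfRising_eq (n : ℕ) : halfRising n = n.centralBinom * n.factorial / 4 ^ n := by
  rw [← four_pow_mul_halfRising]
  field_simp

theorem neg_one_pow_sq (n : ℕ) : ((-1 : ℚ) ^ n) ^ 2 = 1 := by
  rw [← pow_mul, mul_comm, pow_mul, neg_one_sq, one_pow]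

theorem neg_sixtyFour_pow (n : ℕ) : (-64 : ℚ) ^ n = (-1) ^ n * (4 ^ n) ^ 3 := by
  rw [← pow_mul, mul_comm n 3, pow_mul, ← mul_pow]
  norm_num

theorem neg_two_pow_ten_pow (n : ℕ) : (-2 ^ 10 : ℚ) ^ n = (-1) ^ n * (4 ^ n) ^ 5 := by
  rw [← pow_mul, mul_comm n 5, pow_mul, ← mul_pow]
  norm_num

theorem sixteen_pow (n : ℕ) : (16 : ℚ) ^ n = (4 ^ n) ^ 2 := by
  rw [← pow_mul, mul_comm n 2, pow_mul]
  norm_num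

theorem cubeF_zero (n : ℕ) :
    cubeF n 0 = (4 * n + 1) * (n.centralBinom : ℚ) ^ 3 / (-64) ^ n := by
  have hf : (n.factorial : ℚ) ≠ 0 := by positivity
  rw [cubeF, neg_sixtyFour_pow, add_zero, halfRising_eq, halfRising_zero,
    Nat.descFactorial_zero]
  field_simp
  simp [neg_one_pow_sq]

theorem cast_factorial_two_mul (n : ℕ) :
    ((2 * n).factorial : ℚ) = n.centralBinom * n.factorial ^ 2 := by
  have h := Nat.choose_mul_factorial_mul_factorial (show n ≤ 2 * n by omega)
  rw [← Nat.centralBinom_eq_two_mul_choose, show 2 * n - n = n by omega] at h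
  rw [← h]
  push_cast
  ring

theorem quarticF_zero (n : ℕ) :
    quarticF n 0 = (20 * n + 3) * (n.centralBinom : ℚ) ^ 2 * (2 * n).centralBinom /
      (-2 ^ 10) ^ n := by
  have hf : (n.factorial : ℚ) ≠ 0 := by positivity
  rw [quarticF, neg_two_pow_ten_pow, sixteen_pow, add_zero, add_zero, halfRising_eq n,
    halfRising_eq (2 * n), cast_factorial_two_mul, halfRising_zero, Nat.descFactorial_zero,
    mul_comm 2 n, pow_mul]
  field_simp
  simp only [neg_one_pow_sq, mul_comm n 2]
  push_cast
  ring

theorem centralBinom_eq_div (n : ℕ) :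
    (n.centralBinom : ℚ) = 4 ^ n * halfRising n / n.factorial := by
  rw [four_pow_mul_halfRising]
  field_simp

theorem halfBinom_eq_div (m k : ℕ) :
    (halfBinom m k : ℚ) = 4 ^ m * halfRising (m + k) / (m.factorial * halfRising k) := by
  have hr := halfRising_ne_zero k
  rw [← halfBinom_mul]
  field_simp

theorem cast_descFactorial_add (j k : ℕ) :
    ((k + j).descFactorial k : ℚ) = (k + j).factorial / j.factorial := by
  have h := Nat.factorial_mul_descFactorial (Nat.le_add_right k j)
  rw [Nat.add_sub_cancel_left] at h
  rw [← h]
  push_cast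
  field_simp

theorem cubeG_succ {n k : ℕ} (hk : k ≤ n) :
    (-64) ^ n * cubeG (n + 1) k = 4 * (2 * n + 1) * n.centralBinom *
      ((-1) ^ k * 4 ^ k / 4 * halfBinom n (k + 1) * halfBinom (n - k) (k + 1)) := by
  obtain ⟨j, rfl⟩ := Nat.exists_eq_add_of_le hk
  have hf : ((k + j).factorial : ℚ) ≠ 0 := by positivity
  have hj : (j.factorial : ℚ) ≠ 0 := by positivity
  have hn : (k : ℚ) + j + 1 ≠ 0 := by positivity
  have hr := halfRising_ne_zero (k + 1)
  have hr' := halfRising_ne_zero (k + j)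
  rw [cubeG, Nat.add_sub_cancel_left, centralBinom_eq_div, halfBinom_eq_div, halfBinom_eq_div,
    neg_sixtyFour_pow, Nat.succ_descFactorial_succ, Nat.factorial_succ,
    show j + (k + 1) = k + j + 1 by ring, show k + j + (k + 1) = k + j + 1 + k by ring]
  push_cast
  rw [cast_descFactorial_add, halfRising_succ (k + j), show k + j + 1 + k = 2 * k + j + 1 by ring]
  push_cast
  field_simp
  ring_nf
  simp only [mul_comm _ 2, mul_comm _ 3, pow_mul]
  norm_num

theorem quarticG_succ {n k : ℕ} (hk : k ≤ n) :
    (-2 ^ 10) ^ n * quarticG (n + 1) k = 4 * (2 * n + 1) * n.centralBinom *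
      ((-1) ^ k * 4 ^ k / 8 * halfBinom (2 * n + 1) (k + 1) * halfBinom (n - k) (k + 1)) := by
  obtain ⟨j, rfl⟩ := Nat.exists_eq_add_of_le hk
  have hf : ((k + j).factorial : ℚ) ≠ 0 := by positivity
  have hj : (j.factorial : ℚ) ≠ 0 := by positivity
  have hn : (k : ℚ) + j + 1 ≠ 0 := by positivity
  have hr := halfRising_ne_zero (k + 1)
  have hr' := halfRising_ne_zero (k + j)
  rw [quarticG, Nat.add_sub_cancel_left, centralBinom_eq_div, halfBinom_eq_div, halfBinom_eq_div,
    neg_two_pow_ten_pow, sixteen_pow, Nat.succ_descFactorial_succ,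
    ← halfRising_succ_mul_factorial, Nat.factorial_succ,
    show j + (k + 1) = k + j + 1 by ring,
    show 2 * (k + j) + 1 + (k + 1) = 2 * (k + j + 1) + k by ring]
  push_cast
  rw [cast_descFactorial_add, halfRising_succ (k + j)]
  push_cast
  field_simp
  ring_nf
  simp only [mul_comm _ 2, mul_comm _ 3, mul_comm _ 4, pow_mul]
  norm_num
  -- Powers of 256 and of 4 must share a base before `ring` can match them.
  have h256 (m : ℕ) : (256 : ℚ) ^ m = (4 ^ m) ^ 4 := by
    rw [← pow_mul, mul_comm m 4, pow_mul]
    norm_num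
  rw [h256, h256]
  ring

/-! ### Integrality of the cofactors -/

theorem exists_int_cast_sum_eq {s : Finset ℕ} {f : ℕ → ℚ} (h : ∀ k ∈ s, ∃ z : ℤ, f k = z) :
    ∃ z : ℤ, ∑ k ∈ s, f k = z := by
  choose! g hg using h
  exact ⟨∑ k ∈ s, g k, by rw [Finset.sum_congr rfl hg]; push_cast; rfl⟩

theorem exists_int_cube_term {n k : ℕ} (hn : 0 < n) :
    ∃ z : ℤ, ((-1) ^ k * 4 ^ k / 4 * halfBinom n (k + 1) * halfBinom (n - k) (k + 1) : ℚ) = z := by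
  rcases k with _ | k
  -- Only `k = 0` leaves a denominator, 4; both coefficients are then `halfBinom n 1`, which is
  -- even.
  · obtain ⟨c, hc⟩ := two_dvd_halfBinom hn 1
    refine ⟨c * c, ?_⟩
    rw [Nat.sub_zero, zero_add, hc]
    push_cast
    ring
  · refine ⟨(-1) ^ (k + 1) * 4 ^ k * halfBinom n (k + 1 + 1) *
      halfBinom (n - (k + 1)) (k + 1 + 1), ?_⟩
    push_cast
    ring

theorem exists_int_quartic_term {n k : ℕ} (hn : 0 < n) :
    ∃ z : ℤ, ((-1) ^ k * 4 ^ k / 8 * halfBinom (2 * n + 1) (k + 1) *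
      halfBinom (n - k) (k + 1) : ℚ) = z := by
  rcases k with _ | k
  -- At `k = 0` the denominator 8 is absorbed as 4 times 2; for larger `k`, `4 ^ k / 8` needs only
  -- one even coefficient.
  · obtain ⟨b, hb⟩ := four_dvd_halfBinom_one hn
    obtain ⟨c, hc⟩ := two_dvd_halfBinom hn 1
    refine ⟨b * c, ?_⟩
    rw [Nat.sub_zero, zero_add, hb, hc]
    push_cast
    ring
  · obtain ⟨b, hb⟩ := two_dvd_halfBinom (Nat.succ_pos (2 * n)) (k + 1 + 1)
    refine ⟨(-1) ^ (k + 1) * 4 ^ k * b * halfBinom (n - (k + 1)) (k + 1 + 1), ?_⟩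
    rw [Nat.succ_eq_add_one] at hb
    rw [hb]
    push_cast
    ring

/-! ### Divisibility of the sums -/

/-- Divisibility of the scaled partial sums, from a Wilf–Zeilberger pair whose companion
has integral values after division by `d`. -/
theorem dvd_sum_of_wz {F G : ℕ → ℕ → ℚ} {t : ℕ → ℚ} {b : ℕ → ℤ} {c d : ℤ} (hc : c ≠ 0) {n : ℕ}
    (hwz : ∀ n k, F n k - F n (k + 1) = G (n + 1) k - G n k)
    (hF : ∀ n k, n < k → F n k = 0) (hG : ∀ k, G 0 k = 0)
    (hb : ∀ k, F k 0 = b k / c ^ k)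
    (ht : ∀ k ≤ n, c ^ n * G (n + 1) k = d * t k) (hz : ∀ k, ∃ z : ℤ, t k = z) :
    d ∣ ∑ k ∈ Finset.range (n + 1), b k * c ^ (n - k) := by
  obtain ⟨z, hz⟩ := exists_int_cast_sum_eq (s := Finset.range (n + 1)) fun k _ => hz k
  refine ⟨z, ?_⟩
  have hc' : (c : ℚ) ≠ 0 := by exact_mod_cast hc
  have h : ∑ k ∈ Finset.range (n + 1), (b k : ℚ) * c ^ (n - k) = d * z := by
    rw [← hz, Finset.mul_sum]
    calc ∑ k ∈ Finset.range (n + 1), (b k : ℚ) * c ^ (n - k)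
        = c ^ n * ∑ k ∈ Finset.range (n + 1), F k 0 := by
          rw [Finset.mul_sum]
          refine Finset.sum_congr rfl fun k hk => ?_
          rw [hb, pow_sub₀ _ hc' (Nat.lt_succ_iff.mp (Finset.mem_range.mp hk))]
          ring
      _ = ∑ k ∈ Finset.range (n + 1), d * t k := by
          rw [sum_eq_sum_of_wz hwz hF hG, Finset.mul_sum]
          exact Finset.sum_congr rfl fun k hk =>
            ht k (Nat.lt_succ_iff.mp (Finset.mem_range.mp hk))
  exact_mod_cast h

theorem theorem1p2 (n : ℕ) (hn : 0 < n) :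
    ((4 * (2 * (n : ℤ) + 1) * (Nat.choose (2 * n) n : ℤ)) ∣
      ∑ k ∈ Finset.range (n + 1),
        (4 * (k : ℤ) + 1) * (Nat.choose (2 * k) k : ℤ) ^ 3 * (-64 : ℤ) ^ (n - k)) ∧
    ((4 * (2 * (n : ℤ) + 1) * (Nat.choose (2 * n) n : ℤ)) ∣
      ∑ k ∈ Finset.range (n + 1),
        (20 * (k : ℤ) + 3) * (Nat.choose (2 * k) k : ℤ) ^ 2 *
          (Nat.choose (4 * k) (2 * k) : ℤ) * (-(2 : ℤ) ^ 10) ^ (n - k)) := by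
  constructor
  · refine dvd_sum_of_wz (by norm_num) cube_wz
      (fun n k h => by simp [cubeF, Nat.descFactorial_of_lt h]) (fun k => by simp [cubeG])
      (fun k => ?_) (fun k hk => ?_) (fun k => exists_int_cube_term (k := k) hn)
    · rw [cubeF_zero, ← Nat.centralBinom_eq_two_mul_choose]
      push_cast
      rfl
    · rw [← Nat.centralBinom_eq_two_mul_choose]
      push_cast
      exact cubeG_succ hk
  · refine dvd_sum_of_wz (by norm_num) quartic_wz
      (fun n k h => by simp [quarticF, Nat.descFactorial_of_lt h])
      (fun k => by simp [quarticG])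
      (fun k => ?_) (fun k hk => ?_) (fun k => exists_int_quartic_term (k := k) hn)
    · rw [quarticF_zero, ← Nat.centralBinom_eq_two_mul_choose,
        show 4 * k = 2 * (2 * k) by ring, ← Nat.centralBinom_eq_two_mul_choose]
      push_cast
      rfl
    · rw [← Nat.centralBinom_eq_two_mul_choose]
      push_cast
      exact quarticG_succ hk
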